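/- **Conventions.** A 2-category $\mathcal A$ is *2-filtered* if it is non-empty and satisfies: * (F0) for all objects $A,B$ there are arrows $A\to C\leftarrow B$; * (FF1) for all $f_i\colon E_i\to A$, $g_i\colon E_i\to B$ ($i=1,2$) there are $u\colon A\to C$, $v\colon B\to C$ and invertible 2-cells $uf_1\cong vg_1$, $uf_2\cong vg_2$ (in particular, (F1): every span $A\xleftarrow{f}E\xrightarrow{g}B$ admits $u,v$ and an invertible 2-cell $uf\cong vg$); * (F2) for all 2-cells $\gamma_i\colon u_if\Rightarrow v_ig$ ($i=1,2$), where $f\colon E\to A$, $g\colon E\to B$, $u_i\colon A\to C_i$, $v_i\colon B\to C_i$, there are $w_i\colon C_i\to C$ and invertible 2-cells $\alpha\colon w_1v_1\cong w_2v_2$, $\beta\colon w_1u_1\cong w_2u_2$ with $(\alpha g)\circ(w_1\gamma_1)=(w_2\gamma_2)\circ(\beta f)$; * (BF2) for all parallel 2-cells $\gamma_1,\gamma_2\colon f\Rightarrow g\colon A\to B$ there is $u\colon B\to C$ with $u\gamma_1=u\gamma_2$. For a 2-functor $F\colon\mathcal A\to\mathcal Cat$, the category $\mathcal L(F)$ has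 as objects the pairs $(x,A)$ with $x\in FA$. A premorphism $(x,A)\to(y,B)$ is a triple $(u,\xi,v)$ with $u\colon A\to C$, $v\colon B\to C$ and $\xi\colon F(u)(x)\to F(v)(y)$ in $FC$; premorphisms $(u_1,\xi_1,v_1)$, $(u_2,\xi_2,v_2)$ are equivalent if there are $w_i\colon C_i\to C$ and invertible 2-cells $\alpha\colon w_1v_1\cong w_2v_2$, $\beta\colon w_1u_1\cong w_2u_2$ with $F(\alpha)_y\circ F(w_1)(\xi_1)=F(w_2)(\xi_2)\circ F(\beta)_x$. Morphisms of $\mathcal L(F)$ are equivalence classes of premorphisms; the composite of $(u,\xi,v)\colon(x,A)\to(y,B)$ and $(h,\zeta,k)\colon(y,B)\to(z,D)$ is represented by $(su,\;F(t)(\zeta)\circ F(\gamma)_y\circ F(s)(\xi),\;tk)$ for any $s,t$ and any invertible $\gamma\colon sv\cong th$. A pseudocone $h$ of $F$ with vertex a category $\mathcal X$ consists of functors $h_A\colon FA\to\mathcal X$ and natural isomorphisms $h_u\colon h_B F(u)\cong h_A$ ($u\colon A\to B$) with $h_{\mathrm{id}}=\mathrm{id}$, $h_{vu}=h_u\circ(h_vF(u))$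 and $h_v\circ(h_BF(\gamma))=h_u$ for $\gamma\colon u\Rightarrow v$; morphisms of pseudocones are modifications. The pseudocone $\lambda$ of $F$ with vertex $\mathcal L(F)$ is given by $\lambda_A(x)=(x,A)$, $\lambda_A(\xi)=[(\mathrm{id},\xi,\mathrm{id})]$ and $\lambda_u(x)=[(\mathrm{id},\mathrm{id},u)]\colon(F(u)x,B)\to(x,A)$. Let $\mathcal Cat_{f\ell}$ be the 2-category of finitely complete categories, finite limit preserving functors and all natural transformations, and let $\mathcal{PC}_{f\ell}[F,\mathcal X]$ be the full subcategory of the category of pseudocones with vertex $\mathcal X$ on those $h$ all of whose functors $h_A$ preserve finite limits. **Theorem.** Let $\mathcal A$ be a 2-filtered 2-category and let $F\colon\mathcal A\to\mathcal Cat_{f\ell}$ be a 2-functor. Then: 1. the category $\mathcal L(F)$ has finite limits; 2. each $\lambda_A\colon FA\to\mathcal L(F)$ preserves finite limits; 3. for every category $\mathcal X$ with finite limits, composition with $\lambda$ is an equivalence of categories $\mathcal Cat_{f\ell}[\mathcal L(F),\mathcal X]\to\mathcal{PC}_{f\ell}[F,\mathcal X]$, so that $\mathcal L(F)$ is also the bicolimit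 of $F$ in $\mathcal Cat_{f\ell}$; this equivalence is in fact an isomorphism of categories. -/

import Mathlib

open CategoryTheory Bicategory Limits

universe w₁ v₁ v₂ v₃ v₄ u₁ u₂ u₃ u₄

namespace LLConstruction

/-- A pre 2-filtered 2-category: axioms F1 and F2. Composition is written in diagrammatic order and
the associators are identities when `A` is a 2-category. -/
class PreTwoFiltered (A : Type u₁) [Bicategory.{w₁, v₁} A] : Prop where
  F1 {e a b : A} (f : e ⟶ a) (g : e ⟶ b) :
    ∃ (c : A) (u : a ⟶ c) (v : b ⟶ c), Nonempty (f ≫ u ≅ g ≫ v)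
  F2 {e a b c₁ c₂ : A} {f : e ⟶ a} {g : e ⟶ b} {u₁ : a ⟶ c₁} {v₁ : b ⟶ c₁}
    {u₂ : a ⟶ c₂} {v₂ : b ⟶ c₂} (γ₁ : f ≫ u₁ ⟶ g ≫ v₁) (γ₂ : f ≫ u₂ ⟶ g ≫ v₂) :
    ∃ (c : A) (w₁ : c₁ ⟶ c) (w₂ : c₂ ⟶ c)
      (α : v₁ ≫ w₁ ≅ v₂ ≫ w₂) (β : u₁ ≫ w₁ ≅ u₂ ≫ w₂),
      γ₁ ▷ w₁ ≫ (α_ g v₁ w₁).hom ≫ g ◁ α.hom ≫ (α_ g v₂ w₂).inv =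
        (α_ f u₁ w₁).hom ≫ f ◁ β.hom ≫ (α_ f u₂ w₂).inv ≫ γ₂ ▷ w₂

/-- A pseudo 2-filtered 2-category. -/
class PseudoTwoFiltered (A : Type u₁) [Bicategory.{w₁, v₁} A] : Prop extends PreTwoFiltered A where
  FF1 {e₁ e₂ a b : A} (f₁ : e₁ ⟶ a) (g₁ : e₁ ⟶ b) (f₂ : e₂ ⟶ a) (g₂ : e₂ ⟶ b) :
    ∃ (c : A) (u : a ⟶ c) (v : b ⟶ c), Nonempty (f₁ ≫ u ≅ g₁ ≫ v) ∧ Nonempty (f₂ ≫ u ≅ g₂ ≫ v)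

/-- Pseudo 2-filtered, non-empty, and any two objects map to a common one. -/
class TwoFiltered (A : Type u₁) [Bicategory.{w₁, v₁} A] : Prop extends PseudoTwoFiltered A where
  nonempty : Nonempty A
  F0 (a b : A) : ∃ c : A, Nonempty (a ⟶ c) ∧ Nonempty (b ⟶ c)

/-- Parallel 2-cells become equal after composition with a suitable 1-cell. -/
def EqualizesTwoCells (A : Type u₁) [Bicategory.{w₁, v₁} A] : Prop :=
  ∀ {a b : A} {f g : a ⟶ b} (γ₁ γ₂ : f ⟶ g), ∃ (c : A) (u : b ⟶ c), γ₁ ▷ u = γ₂ ▷ u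

variable {A : Type u₁} [Bicategory.{w₁, v₁} A] (F : A ⥤ᵖ Cat.{v₂, u₂})

/-- The object `F(u)(x)`, abbreviated `ux`. -/
abbrev act {a b : A} (u : a ⟶ b) (x : F.obj a) : F.obj b := (F.map u).toFunctor.obj x

/-- The component `F(α)_x : ux ⟶ vx` for a 2-cell `α : u ⟶ v`. -/
abbrev cell {a b : A} {u v : a ⟶ b} (α : u ⟶ v) (x : F.obj a) : act F u x ⟶ act F v x :=
  (F.map₂ α).toNatTrans.app x

/-- `F(w)(ξ)`, regarded as an arrow `(w ∘ u)x ⟶ (w ∘ v)y` through the identities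
`F(w ∘ u) = F(w) F(u)` and `F(w ∘ v) = F(w) F(v)` of the 2-functor `F`. -/
def push {a b c d : A} {u : a ⟶ c} {v : b ⟶ c} {x : F.obj a} {y : F.obj b} (w : c ⟶ d)
    (ξ : act F u x ⟶ act F v y) : act F (u ≫ w) x ⟶ act F (v ≫ w) y :=
  (F.mapComp u w).hom.toNatTrans.app x ≫ (F.map w).toFunctor.map ξ ≫
    (F.mapComp v w).inv.toNatTrans.app y

variable {F}
section cells

variable {a b b' c d e : A} {u u' : a ⟶ c} {v v' : b ⟶ c} {t : b' ⟶ c}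
  {x : F.obj a} {y : F.obj b} {z : F.obj b'}

lemma cell_comp {u v w : a ⟶ c} (α : u ⟶ v) (β : v ⟶ w) (x : F.obj a) :
    cell F (α ≫ β) x = cell F α x ≫ cell F β x := by
  simp [cell]

lemma cell_id (u : a ⟶ c) (x : F.obj a) : cell F (𝟙 u) x = 𝟙 _ := by
  simp [cell]

lemma push_comp (w : c ⟶ d) (ξ : act F u x ⟶ act F v y) (ζ : act F v y ⟶ act F t z) :
    push F w (ξ ≫ ζ) = push F w ξ ≫ push F w ζ := by
  simp [push]

lemma push_id (w : c ⟶ d) :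
    push F w (𝟙 (act F u x)) = 𝟙 _ := by
  simp [push]

lemma push_cell (w : c ⟶ d) (α : u ⟶ u') :
    push F w (cell F α x) = cell F (α ▷ w) x := by
  simp [push, cell]

lemma push_nat {w w' : c ⟶ d} (β : w ⟶ w') (ξ : act F u x ⟶ act F v y) :
    push F w ξ ≫ cell F (v ◁ β) y = cell F (u ◁ β) x ≫ push F w' ξ := by
  simp [push, cell]

lemma push_push (w : c ⟶ d) (w' : d ⟶ e) (ξ : act F u x ⟶ act F v y) :
    push F w' (push F w ξ) =
      cell F (α_ u w w').hom x ≫ push F (w ≫ w') ξ ≫ cell F (α_ v w w').inv y := by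
  have h := congr($(F.mapComp_assoc_left_inv v w w').toNatTrans.app y)
  have n := (F.mapComp w w').inv.toNatTrans.naturality ξ
  simp at h n
  simp [push, cell, h, reassoc_of% n]

lemma push_one (ξ : act F u x ⟶ act F v y) :
    push F (𝟙 c) ξ = cell F (ρ_ u).hom x ≫ ξ ≫ cell F (ρ_ v).inv y := by
  have h := congr($(F.mapComp_id_right_inv v).toNatTrans.app y)
  have n : (F.map (𝟙 c)).toFunctor.map ξ ≫ (F.mapId c).hom.toNatTrans.app _ =
    (F.mapId c).hom.toNatTrans.app _ ≫ ξ := (F.mapId c).hom.toNatTrans.naturality ξ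
  simp at h
  simp [push, cell, h, reassoc_of% n]


lemma cell_hom_inv {u v : a ⟶ c} (α : u ≅ v) (x : F.obj a) :
    cell F α.hom x ≫ cell F α.inv x = 𝟙 _ := by
  rw [← cell_comp, α.hom_inv_id, cell_id]

lemma cell_inv_hom {u v : a ⟶ c} (α : u ≅ v) (x : F.obj a) :
    cell F α.inv x ≫ cell F α.hom x = 𝟙 _ := by
  rw [← cell_comp, α.inv_hom_id, cell_id]

lemma cell_hom_inv_assoc {u v : a ⟶ c} (α : u ≅ v) (x : F.obj a) {p : F.obj c}
    (h : act F u x ⟶ p) : cell F α.hom x ≫ cell F α.inv x ≫ h = h := by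
  rw [← Category.assoc, cell_hom_inv, Category.id_comp]

lemma cell_inv_hom_assoc {u v : a ⟶ c} (α : u ≅ v) (x : F.obj a) {p : F.obj c}
    (h : act F v x ⟶ p) : cell F α.inv x ≫ cell F α.hom x ≫ h = h := by
  rw [← Category.assoc, cell_inv_hom, Category.id_comp]

lemma push_map {a b c : A} {x y : F.obj a} (f : x ⟶ y) (u : a ⟶ b) (w : b ⟶ c) :
    push F w ((F.map u).toFunctor.map f) = (F.map (u ≫ w)).toFunctor.map f := by
  have n : (F.map (u ≫ w)).toFunctor.map f ≫ (F.mapComp u w).hom.toNatTrans.app y =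
      (F.mapComp u w).hom.toNatTrans.app x ≫ (F.map w).toFunctor.map ((F.map u).toFunctor.map f) :=
    (F.mapComp u w).hom.toNatTrans.naturality f
  simp [push, ← reassoc_of% n]

lemma push_mapId {a b c : A} (u : a ⟶ b) (w : b ⟶ c) (x : F.obj a) :
    push F w ((F.mapId b).hom.toNatTrans.app (act F u x)) =
      cell F (λ_ w).hom (act F u x) ≫ (F.mapComp u w).inv.toNatTrans.app x := by
  simp [push, cell]

lemma mapComp_inv_cell {a b c : A} (u : a ⟶ b) {w w' : b ⟶ c} (β : w ⟶ w') (x : F.obj a) :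
    (F.mapComp u w).inv.toNatTrans.app x ≫ cell F (u ◁ β) x =
      cell F β (act F u x) ≫ (F.mapComp u w').inv.toNatTrans.app x := by
  simp [cell]

/-- The square with horizontal sides `ξ`, `ξ'` and vertical sides given by 2-cells commutes. -/
def Square (β : u ⟶ u') (ξ : act F u x ⟶ act F v y) (α : v ⟶ v')
    (ξ' : act F u' x ⟶ act F v' y) : Prop :=
  ξ ≫ cell F α y = cell F β x ≫ ξ'

namespace Square

lemma id (ξ : act F u x ⟶ act F v y) : Square (𝟙 u) ξ (𝟙 v) ξ := by
  simp [Square, cell_id]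

lemma comp {u'' : a ⟶ c} {v'' : b ⟶ c} {β : u ⟶ u'} {α : v ⟶ v'} {β' : u' ⟶ u''}
    {α' : v' ⟶ v''} {ξ : act F u x ⟶ act F v y} {ξ' : act F u' x ⟶ act F v' y}
    {ξ'' : act F u'' x ⟶ act F v'' y} (h : Square β ξ α ξ') (h' : Square β' ξ' α' ξ'') :
    Square (β ≫ β') ξ (α ≫ α') ξ'' := by
  unfold Square at *
  rw [cell_comp, cell_comp, reassoc_of% h, h', Category.assoc]

lemma inv {β : u ≅ u'} {α : v ≅ v'} {ξ : act F u x ⟶ act F v y}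
    {ξ' : act F u' x ⟶ act F v' y} (h : Square β.hom ξ α.hom ξ') :
    Square β.inv ξ' α.inv ξ := by
  unfold Square at *
  have := cell F β.inv x ≫= h =≫ cell F α.inv y
  simp only [Category.assoc, cell_hom_inv, Category.comp_id, cell_inv_hom_assoc] at this
  exact this.symm

lemma whisker {β : u ⟶ u'} {α : v ⟶ v'} {ξ : act F u x ⟶ act F v y}
    {ξ' : act F u' x ⟶ act F v' y} (h : Square β ξ α ξ') (w : c ⟶ d) :
    Square (β ▷ w) (push F w ξ) (α ▷ w) (push F w ξ') := by
  unfold Square at *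
  rw [← push_cell, ← push_cell, ← push_comp, ← push_comp, h]

lemma nat {w w' : c ⟶ d} (β : w ⟶ w') (ξ : act F u x ⟶ act F v y) :
    Square (u ◁ β) (push F w ξ) (v ◁ β) (push F w' ξ) :=
  push_nat β ξ

lemma assoc (w : c ⟶ d) (w' : d ⟶ e) (ξ : act F u x ⟶ act F v y) :
    Square (α_ u w w').hom (push F w' (push F w ξ)) (α_ v w w').hom (push F (w ≫ w') ξ) := by
  unfold Square
  rw [push_push]
  simp only [Category.assoc, cell_inv_hom, Category.comp_id]

lemma unit (ξ : act F u x ⟶ act F v y) :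
    Square (ρ_ u).hom (push F (𝟙 c) ξ) (ρ_ v).hom ξ := by
  unfold Square
  rw [push_one]
  simp only [Category.assoc, cell_inv_hom, Category.comp_id]

end Square

end cells

variable (F) in
/-- The objects of the category `L(F)`: pairs `(x, A)` with `x` an object of `F A`. -/
structure LL where
  base : A
  pt : F.obj base

/-- A premorphism `(x, A) ⟶ (y, B)`: a triple `(u, ξ, v)` with `u : A ⟶ C`, `v : B ⟶ C` and
`ξ : F(u)(x) ⟶ F(v)(y)` in `F C`. -/
structure Premor (x y : LL F) where
  apex : A
  u : x.base ⟶ apex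
  v : y.base ⟶ apex
  ξ : act F u x.pt ⟶ act F v y.pt

namespace Premor

/-- There is a homotopy `(w₁, w₂, α, β)` between two premorphisms: invertible 2-cells
`α : w₁ ∘ v₁ ≅ w₂ ∘ v₂`, `β : w₁ ∘ u₁ ≅ w₂ ∘ u₂` with `αy ∘ w₁ξ₁ = w₂ξ₂ ∘ βx`. -/
def Homotopic {x y : LL F} (f₁ f₂ : Premor x y) : Prop :=
  ∃ (c : A) (w₁ : f₁.apex ⟶ c) (w₂ : f₂.apex ⟶ c)
    (α : f₁.v ≫ w₁ ≅ f₂.v ≫ w₂) (β : f₁.u ≫ w₁ ≅ f₂.u ≫ w₂),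
    push F w₁ f₁.ξ ≫ cell F α.hom y.pt = cell F β.hom x.pt ≫ push F w₂ f₂.ξ

variable {x y z t : LL F}

lemma Homotopic.refl (f : Premor x y) : Homotopic f f :=
  ⟨_, 𝟙 _, 𝟙 _, Iso.refl _, Iso.refl _, by simp [cell_id]⟩

lemma Homotopic.symm {f g : Premor x y} (h : Homotopic f g) : Homotopic g f := by
  obtain ⟨c, w₁, w₂, α, β, h⟩ := h
  exact ⟨c, w₂, w₁, α.symm, β.symm, Square.inv h⟩

lemma Homotopic.of_square {c : A} {u u' : x.base ⟶ c} {v v' : y.base ⟶ c} (β : u ≅ u')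
    (α : v ≅ v') {ξ : act F u x.pt ⟶ act F v y.pt} {ξ' : act F u' x.pt ⟶ act F v' y.pt}
    (h : Square β.hom ξ α.hom ξ') : Homotopic (mk c u v ξ) (mk c u' v' ξ') :=
  ⟨c, 𝟙 c, 𝟙 c, whiskerRightIso α _, whiskerRightIso β _, h.whisker _⟩

lemma Homotopic.of_push {c d : A} {u : x.base ⟶ c} {v : y.base ⟶ c} (w : c ⟶ d)
    (ξ : act F u x.pt ⟶ act F v y.pt) :
    Homotopic (mk c u v ξ) (mk d (u ≫ w) (v ≫ w) (push F w ξ)) :=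
  ⟨d, w, 𝟙 d, (ρ_ _).symm, (ρ_ _).symm, (Square.unit _).inv⟩

lemma Homotopic.lift_eq {T : Sort*} (φ : Premor x y → T)
    (h₁ : ∀ {c : A} {u u' : x.base ⟶ c} {v v' : y.base ⟶ c} (β : u ≅ u') (α : v ≅ v')
      (ξ : act F u x.pt ⟶ act F v y.pt) (ξ' : act F u' x.pt ⟶ act F v' y.pt),
      Square β.hom ξ α.hom ξ' → φ (mk c u v ξ) = φ (mk c u' v' ξ'))
    (h₂ : ∀ {c d : A} {u : x.base ⟶ c} {v : y.base ⟶ c} (w : c ⟶ d)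
      (ξ : act F u x.pt ⟶ act F v y.pt),
      φ (mk c u v ξ) = φ (mk d (u ≫ w) (v ≫ w) (push F w ξ)))
    {f g : Premor x y} (h : Homotopic f g) : φ f = φ g := by
  obtain ⟨c, w₁, w₂, α, β, e⟩ := h
  exact (h₂ w₁ f.ξ).trans ((h₁ β α _ _ e).trans (h₂ w₂ g.ξ).symm)

variable [PreTwoFiltered A]

lemma Homotopic.trans {f g h : Premor x y} (H : Homotopic f g) (H' : Homotopic g h) :
    Homotopic f h := by
  obtain ⟨c, w₁, w₂, α, β, e⟩ := H
  obtain ⟨c', w₂', w₃, α', β', e'⟩ := H'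
  obtain ⟨d, p, q, ⟨γ⟩⟩ := PreTwoFiltered.F1 w₂ w₂'
  refine ⟨d, w₁ ≫ p, w₃ ≫ q,
    (α_ _ _ _).symm ≪≫ whiskerRightIso α p ≪≫ α_ _ _ _ ≪≫ whiskerLeftIso _ γ ≪≫
      (α_ _ _ _).symm ≪≫ whiskerRightIso α' q ≪≫ α_ _ _ _,
    (α_ _ _ _).symm ≪≫ whiskerRightIso β p ≪≫ α_ _ _ _ ≪≫ whiskerLeftIso _ γ ≪≫
      (α_ _ _ _).symm ≪≫ whiskerRightIso β' q ≪≫ α_ _ _ _, ?_⟩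
  exact (Square.assoc w₁ p f.ξ).inv.comp <| (Square.whisker e p).comp <|
    (Square.assoc w₂ p g.ξ).comp <| (Square.nat γ.hom g.ξ).comp <|
    (Square.assoc w₂' q g.ξ).inv.comp <| (Square.whisker e' q).comp (Square.assoc w₃ q h.ξ)

variable (x y) in
/-- Equivalence of premorphisms: the existence of a homotopy. -/
def setoid : Setoid (Premor x y) where
  r := Homotopic
  iseqv := ⟨Homotopic.refl, Homotopic.symm, Homotopic.trans⟩

/-- The composite of two premorphisms over an invertible 2-cell `γ`. -/
@[simps]
def compOver (f : Premor x y) (g : Premor y z) {d : A} (s : f.apex ⟶ d) (t : g.apex ⟶ d)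
    (γ : f.v ≫ s ≅ g.u ≫ t) : Premor x z where
  apex := d
  u := f.u ≫ s
  v := g.v ≫ t
  ξ := push F s f.ξ ≫ cell F γ.hom y.pt ≫ push F t g.ξ

lemma compOver_homotopic (f : Premor x y) (g : Premor y z) {d d' : A} (s : f.apex ⟶ d)
    (t : g.apex ⟶ d) (γ : f.v ≫ s ≅ g.u ≫ t) (s' : f.apex ⟶ d') (t' : g.apex ⟶ d')
    (γ' : f.v ≫ s' ≅ g.u ≫ t') :
    Homotopic (f.compOver g s t γ) (f.compOver g s' t' γ') := by
  obtain ⟨e, w₁, w₂, α, β, h⟩ := PreTwoFiltered.F2 γ.hom γ'.hom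
  refine ⟨e, w₁, w₂, α_ _ _ _ ≪≫ whiskerLeftIso _ α ≪≫ (α_ _ _ _).symm,
    α_ _ _ _ ≪≫ whiskerLeftIso _ β ≪≫ (α_ _ _ _).symm, ?_⟩
  have h1 := (Square.assoc s w₁ f.ξ).comp ((Square.nat β.hom f.ξ).comp (Square.assoc s' w₂ f.ξ).inv)
  have h2 := (Square.assoc t w₁ g.ξ).comp ((Square.nat α.hom g.ξ).comp (Square.assoc t' w₂ g.ξ).inv)
  have h3 := congrArg (cell F · y.pt) h
  unfold Square at h1 h2
  simp only [cell_comp] at h1 h2 h3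
  simp only [compOver, push_comp, Iso.trans_hom, Iso.symm_hom, whiskerLeftIso_hom,
    push_cell, cell_comp, Category.assoc] at h1 ⊢
  rw [h2, Category.assoc, Category.assoc, reassoc_of% h3, reassoc_of% h1]

/-- A composite of two premorphisms, over a 2-cell provided by axiom F1. -/
noncomputable def chosenComp (f : Premor x y) (g : Premor y z) : Premor x z :=
  let h := PreTwoFiltered.F1 f.v g.u
  f.compOver g h.choose_spec.choose h.choose_spec.choose_spec.choose
    h.choose_spec.choose_spec.choose_spec.some

lemma chosenComp_homotopic (f : Premor x y) (g : Premor y z) {d : A} (s : f.apex ⟶ d)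
    (t : g.apex ⟶ d) (γ : f.v ≫ s ≅ g.u ≫ t) :
    Homotopic (f.chosenComp g) (f.compOver g s t γ) :=
  compOver_homotopic ..

lemma mk_chosenComp (f : Premor x y) (g : Premor y z) {d : A} (s : f.apex ⟶ d)
    (t : g.apex ⟶ d) (γ : f.v ≫ s ≅ g.u ≫ t) :
    Quotient.mk (setoid x z) (f.chosenComp g) = Quotient.mk _ (f.compOver g s t γ) :=
  Quotient.sound (s := setoid x z) (chosenComp_homotopic ..)

lemma chosenComp_congr_left {f f' : Premor x y} (h : Homotopic f f') (g : Premor y z) :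
    Quotient.mk (setoid x z) (f.chosenComp g) = Quotient.mk _ (f'.chosenComp g) := by
  refine Homotopic.lift_eq (fun f => Quotient.mk (setoid x z) (f.chosenComp g)) ?_ ?_ h
  · intro c u u' v v' β α ξ ξ' H
    obtain ⟨d, s, t, ⟨γ⟩⟩ := PreTwoFiltered.F1 v' g.u
    rw [mk_chosenComp (mk c u' v' ξ') g s t γ,
      mk_chosenComp (mk c u v ξ) g s t (whiskerRightIso α s ≪≫ γ)]
    refine Quotient.sound (s := setoid x z)
      (Homotopic.of_square (whiskerRightIso β s) (Iso.refl _) ?_)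
    have := H.whisker s
    unfold Square at this ⊢
    simp [cell_comp, cell_id, reassoc_of% this]
  · intro c d u v w ξ
    obtain ⟨e, s, t, ⟨γ⟩⟩ := PreTwoFiltered.F1 (v ≫ w) g.u
    rw [mk_chosenComp (mk d (u ≫ w) (v ≫ w) (push F w ξ)) _ s t γ,
      mk_chosenComp (mk c u v ξ) _ (w ≫ s) t ((α_ _ _ _).symm ≪≫ γ)]
    refine Quotient.sound (s := setoid x z)
      (Homotopic.of_square (α_ _ _ _).symm (Iso.refl _) ?_)
    have := (Square.assoc w s ξ).inv
    unfold Square at this ⊢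
    simp [cell_comp, cell_id, reassoc_of% this]

lemma chosenComp_congr_right (f : Premor x y) {g g' : Premor y z} (h : Homotopic g g') :
    Quotient.mk (setoid x z) (f.chosenComp g) = Quotient.mk _ (f.chosenComp g') := by
  refine Homotopic.lift_eq (fun g => Quotient.mk (setoid x z) (f.chosenComp g)) ?_ ?_ h
  · intro c u u' v v' β α ξ ξ' H
    obtain ⟨d, s, t, ⟨γ⟩⟩ := PreTwoFiltered.F1 f.v u'
    rw [mk_chosenComp f (mk c u' v' ξ') s t γ,
      mk_chosenComp f (mk c u v ξ) s t (γ ≪≫ (whiskerRightIso β t).symm)]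
    refine Quotient.sound (s := setoid x z)
      (Homotopic.of_square (Iso.refl _) (whiskerRightIso α t) ?_)
    have := H.whisker t
    have k := cell_inv_hom_assoc (whiskerRightIso β t) y.pt (push F t ξ')
    unfold Square at this ⊢
    simp only [whiskerRightIso_hom, whiskerRightIso_inv] at k
    simp [cell_comp, cell_id, this, k]
  · intro c d u v w ξ
    obtain ⟨e, s, t, ⟨γ⟩⟩ := PreTwoFiltered.F1 f.v (u ≫ w)
    rw [mk_chosenComp _ (mk d (u ≫ w) (v ≫ w) (push F w ξ)) s t γ,
      mk_chosenComp _ (mk c u v ξ) s (w ≫ t) (γ ≪≫ (α_ _ _ _))]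
    refine Quotient.sound (s := setoid x z)
      (Homotopic.of_square (Iso.refl _) (α_ _ _ _).symm ?_)
    have := (Square.assoc w t ξ).inv
    unfold Square at this ⊢
    simp [cell_comp, cell_id, this, cell_hom_inv_assoc]

end Premor

namespace LL

variable [PreTwoFiltered A]

variable {x y z : LL F}

/-- The equivalence class of a premorphism. -/
abbrev mor (f : Premor x y) : Quotient (Premor.setoid x y) := Quotient.mk _ f

lemma mor_eq {f g : Premor x y} (h : Premor.Homotopic f g) : mor f = mor g :=
  Quotient.sound (s := Premor.setoid x y) h

variable (x) in
/-- The identity premorphism. -/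
def idPremor : Premor x x := ⟨x.base, 𝟙 _, 𝟙 _, 𝟙 _⟩

/-- Morphisms of `L(F)` are equivalence classes of premorphisms, composed through representatives. -/
noncomputable instance : CategoryStruct (LL F) where
  Hom x y := Quotient (Premor.setoid x y)
  id x := mor (idPremor x)
  comp := Quotient.lift₂ (fun f g => mor (f.chosenComp g))
    (fun _ g f' _ hf hg => (Premor.chosenComp_congr_left hf g).trans
      (Premor.chosenComp_congr_right f' hg))

/-- The morphism of `L(F)` represented by a premorphism. -/
def ofPremor (f : Premor x y) : x ⟶ y := mor f

lemma ofPremor_eq {f g : Premor x y} (h : Premor.Homotopic f g) : ofPremor f = ofPremor g :=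
  mor_eq h

lemma id_def (x : LL F) : 𝟙 x = ofPremor (idPremor x) := rfl

lemma ofPremor_surj (f : x ⟶ y) : ∃ p : Premor x y, ofPremor p = f := Quotient.exists_rep f

lemma ofPremor_comp (f : Premor x y) (g : Premor y z) {d : A} (s : f.apex ⟶ d)
    (t : g.apex ⟶ d) (γ : f.v ≫ s ≅ g.u ≫ t) :
    ofPremor f ≫ ofPremor g = ofPremor (f.compOver g s t γ) :=
  Premor.mk_chosenComp f g s t γ

lemma ofPremor_congr {a b c : A} {x : F.obj a} {y : F.obj b} {u : a ⟶ c} {v : b ⟶ c}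
    {ξ ξ' : act F u x ⟶ act F v y} (h : ξ = ξ') :
    ofPremor (x := ⟨a, x⟩) (y := ⟨b, y⟩) ⟨c, u, v, ξ⟩ = ofPremor ⟨c, u, v, ξ'⟩ := by
  rw [h]

lemma ofPremor_comp_same {c : A} {u : x.base ⟶ c} {v : y.base ⟶ c} {r : z.base ⟶ c}
    (ξ : act F u x.pt ⟶ act F v y.pt) (ζ : act F v y.pt ⟶ act F r z.pt) :
    ofPremor ⟨c, u, v, ξ⟩ ≫ ofPremor ⟨c, v, r, ζ⟩ = ofPremor ⟨c, u, r, ξ ≫ ζ⟩ := by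
  rw [ofPremor_comp ⟨c, u, v, ξ⟩ ⟨c, v, r, ζ⟩ (𝟙 c) (𝟙 c) (Iso.refl _),
    ofPremor_eq (Premor.Homotopic.of_push (𝟙 c) (ξ ≫ ζ))]
  simp [Premor.compOver, cell_id, push_comp]

/-- The category `L(F)`. -/
noncomputable instance : Category (LL F) where
  id_comp f := by
    obtain ⟨⟨c, u, v, ξ⟩, rfl⟩ := ofPremor_surj f
    rw [id_def, ofPremor_comp _ _ u (𝟙 c) ((λ_ u) ≪≫ (ρ_ u).symm)]
    refine ofPremor_eq (Premor.Homotopic.of_square (λ_ _) (ρ_ _) ?_)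
    have := Square.unit ξ
    unfold Square at this ⊢
    simp [idPremor, this, push_id, cell_comp, cell_inv_hom_assoc]
  comp_id f := by
    obtain ⟨⟨c, u, v, ξ⟩, rfl⟩ := ofPremor_surj f
    rw [id_def, ofPremor_comp _ _ (𝟙 c) v ((ρ_ v) ≪≫ (λ_ v).symm)]
    refine ofPremor_eq (Premor.Homotopic.of_square (ρ_ _) (λ_ _) ?_)
    have := Square.unit ξ
    unfold Square at this ⊢
    simp [idPremor, reassoc_of% this, push_id, cell_comp, cell_inv_hom]
  assoc f g h := by
    obtain ⟨f, rfl⟩ := ofPremor_surj f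
    obtain ⟨g, rfl⟩ := ofPremor_surj g
    obtain ⟨h, rfl⟩ := ofPremor_surj h
    obtain ⟨c, s, t, ⟨γ₁⟩⟩ := PreTwoFiltered.F1 f.v g.u
    obtain ⟨d, p, q, ⟨γ₂⟩⟩ := PreTwoFiltered.F1 g.v h.u
    obtain ⟨e, a, b, ⟨γ₃⟩⟩ := PreTwoFiltered.F1 t p
    rw [ofPremor_comp f g s t γ₁, ofPremor_comp g h p q γ₂,
      ofPremor_comp (f.compOver g s t γ₁) h a (q ≫ b)
        (α_ _ _ _ ≪≫ whiskerLeftIso _ γ₃ ≪≫ (α_ _ _ _).symm ≪≫ whiskerRightIso γ₂ b ≪≫ α_ _ _ _),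
      ofPremor_comp f (g.compOver h p q γ₂) (s ≫ a) b
        ((α_ _ _ _).symm ≪≫ whiskerRightIso γ₁ a ≪≫ α_ _ _ _ ≪≫ whiskerLeftIso _ γ₃ ≪≫
          (α_ _ _ _).symm)]
    refine ofPremor_eq (Premor.Homotopic.of_square (α_ _ _ _) (α_ _ _ _).symm ?_)
    have h1 := push_push s a f.ξ
    have h2 := push_push t a g.ξ
    have h3 := push_push p b g.ξ
    have h4 := push_push q b h.ξ
    have n := push_nat γ₃.hom g.ξ
    have key : (push F a (push F s f.ξ ≫ cell F γ₁.hom _ ≫ push F t g.ξ) ≫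
        cell F ((α_ g.v t a).hom ≫ g.v ◁ γ₃.hom ≫ (α_ g.v p b).inv ≫ γ₂.hom ▷ b ≫
          (α_ h.u q b).hom) _ ≫ push F (q ≫ b) h.ξ) ≫ cell F (α_ h.v q b).inv _ =
        cell F (α_ f.u s a).hom _ ≫ push F (s ≫ a) f.ξ ≫
          cell F ((α_ f.v s a).inv ≫ γ₁.hom ▷ a ≫ (α_ g.u t a).hom ≫ g.u ◁ γ₃.hom ≫
            (α_ g.u p b).inv) _ ≫
          push F b (push F p g.ξ ≫ cell F γ₂.hom _ ≫ push F q h.ξ) := by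
      simp only [h1, h2, h3, h4, push_comp, push_cell, cell_comp, cell_inv_hom_assoc,
        Category.assoc, reassoc_of% n]
    exact key


variable (F) in
/-- The functor `λ_A : F A ⥤ L(F)`, `x ↦ (x, A)`, `ξ ↦ [(id, ξ, id)]`. -/
@[simps]
noncomputable def ι (a : A) : F.obj a ⥤ LL F where
  obj x := ⟨a, x⟩
  map {x y} f := ofPremor (x := ⟨a, x⟩) (y := ⟨a, y⟩)
    ⟨a, 𝟙 a, 𝟙 a, (F.map (𝟙 a)).toFunctor.map f⟩
  map_id x := by simp [id_def, idPremor]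
  map_comp f g := by simp [ofPremor_comp_same]

lemma ι_map_eq {a b : A} {x y : F.obj a} (f : x ⟶ y) (u : a ⟶ b) :
    (ι F a).map f = ofPremor (x := ⟨a, x⟩) (y := ⟨a, y⟩) ⟨b, u, u, (F.map u).toFunctor.map f⟩ := by
  refine ofPremor_eq ((Premor.Homotopic.of_push u _).trans
    (Premor.Homotopic.of_square (λ_ u) (λ_ u) ?_))
  rw [push_map]
  exact (F.map₂ (λ_ u).hom).toNatTrans.naturality f

lemma id_eq {a b : A} (x : F.obj a) (u : a ⟶ b) :
    𝟙 (⟨a, x⟩ : LL F) = ofPremor ⟨b, u, u, 𝟙 _⟩ := by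
  refine ((ι F a).map_id x).symm.trans ((ι_map_eq (𝟙 x) u).trans (ofPremor_congr ?_))
  simp

variable (F) in
/-- The isomorphism `λ_u(x) = [(id, id, u)] : (ux, B) ≅ (x, A)` for `u : A ⟶ B`. -/
noncomputable def transIso {a b : A} (u : a ⟶ b) (x : F.obj a) :
    (⟨b, (F.map u).toFunctor.obj x⟩ : LL F) ≅ ⟨a, x⟩ where
  hom := ofPremor ⟨b, 𝟙 b, u, (F.mapId b).hom.toNatTrans.app ((F.map u).toFunctor.obj x)⟩
  inv := ofPremor ⟨b, u, 𝟙 b, (F.mapId b).inv.toNatTrans.app ((F.map u).toFunctor.obj x)⟩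
  hom_inv_id := by
    refine (ofPremor_comp_same _ _).trans (Eq.trans ?_ (id_eq (act F u x) (𝟙 b)).symm)
    simp
  inv_hom_id := by
    refine (ofPremor_comp_same _ _).trans (Eq.trans ?_ (id_eq x u).symm)
    simp

lemma transIso_naturality {a b : A} (u : a ⟶ b) {x y : F.obj a} (f : x ⟶ y) :
    (ι F b).map ((F.map u).toFunctor.map f) ≫ (transIso F u y).hom =
      (transIso F u x).hom ≫ (ι F a).map f := by
  rw [ι_map_eq f u]
  refine (ofPremor_comp_same _ _).trans (Eq.trans ?_ (ofPremor_comp_same _ _).symm)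
  congr 2
  exact (F.mapId b).hom.toNatTrans.naturality _

variable (F) in
/-- The natural isomorphism `λ_u : λ_B ∘ F(u) ≅ λ_A`. -/
noncomputable def ιTrans {a b : A} (u : a ⟶ b) : (F.map u).toFunctor ⋙ ι F b ≅ ι F a :=
  NatIso.ofComponents (transIso F u) (transIso_naturality u)

lemma transIso_id (a : A) (x : F.obj a) :
    (transIso F (𝟙 a) x).hom = (ι F a).map ((F.mapId a).hom.toNatTrans.app x) := by
  refine ofPremor_congr ?_
  have n : (F.map (𝟙 a)).toFunctor.map ((F.mapId a).hom.toNatTrans.app x) ≫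
      (F.mapId a).hom.toNatTrans.app x = (F.mapId a).hom.toNatTrans.app _ ≫
      (F.mapId a).hom.toNatTrans.app x :=
    (F.mapId a).hom.toNatTrans.naturality ((F.mapId a).hom.toNatTrans.app x)
  exact (cancel_mono ((Cat.Hom.toNatIso (F.mapId a)).app x).hom).1 n.symm

lemma transIso_comp {a b c : A} (u : a ⟶ b) (v : b ⟶ c) (x : F.obj a) :
    (transIso F (u ≫ v) x).hom =
      (ι F c).map ((F.mapComp u v).hom.toNatTrans.app x) ≫
        (transIso F v ((F.map u).toFunctor.obj x)).hom ≫ (transIso F u x).hom := by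
  have h : (transIso F u x).hom = ofPremor ⟨c, v, u ≫ v, (F.mapComp u v).inv.toNatTrans.app x⟩ := by
    refine ofPremor_eq ((Premor.Homotopic.of_push v _).trans
      (Premor.Homotopic.of_square (λ_ v) (Iso.refl _) ?_))
    unfold Square
    simp [push, cell]
  rw [h]
  refine Eq.symm ((congrArg (_ ≫ ·) (ofPremor_comp_same _ _)).trans
    ((ofPremor_comp_same _ _).trans (ofPremor_congr ?_)))
  have n : (F.map (𝟙 c)).toFunctor.map ((F.mapComp u v).hom.toNatTrans.app x) ≫
      (F.mapId c).hom.toNatTrans.app ((F.map v).toFunctor.obj ((F.map u).toFunctor.obj x)) = (F.mapId c).hom.toNatTrans.app _ ≫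
      (F.mapComp u v).hom.toNatTrans.app x :=
    (F.mapId c).hom.toNatTrans.naturality ((F.mapComp u v).hom.toNatTrans.app x)
  exact (Category.assoc _ _ _).symm.trans
    ((Iso.comp_inv_eq ((Cat.Hom.toNatIso (F.mapComp u v)).app x)).2 n)

lemma cell_homotopic {a b : A} {u v : a ⟶ b} (γ : u ⟶ v) (x : F.obj a) :
    Premor.Homotopic (x := ⟨b, act F u x⟩) (y := ⟨a, x⟩)
      ⟨b, 𝟙 b, v, (F.mapId b).hom.toNatTrans.app (act F u x) ≫ cell F γ x⟩
      ⟨b, 𝟙 b, u, (F.mapId b).hom.toNatTrans.app (act F u x)⟩ := by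
  obtain ⟨c, w₁, w₂, α, β, h⟩ := PreTwoFiltered.F2 ((ρ_ u).hom ≫ γ ≫ (λ_ v).inv)
    ((ρ_ u).hom ≫ (λ_ u).inv)
  refine ⟨c, w₁, w₂, α, β, ?_⟩
  have k : γ ▷ w₁ ≫ α.hom = u ◁ ((λ_ w₁).inv ≫ β.hom ≫ (λ_ w₂).hom) := by
    calc γ ▷ w₁ ≫ α.hom = (ρ_ u).inv ▷ w₁ ≫ (((ρ_ u).hom ≫ γ ≫ (λ_ v).inv) ▷ w₁ ≫
          (α_ (𝟙 a) v w₁).hom ≫ 𝟙 a ◁ α.hom ≫ (α_ (𝟙 a) u w₂).inv) ≫ (λ_ u).hom ▷ w₂ := by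
            bicategory
      _ = _ := by
        rw [h]
        bicategory
  have k' := congrArg (cell F · x) k
  simp only [cell_comp] at k'
  change push F w₁ ((F.mapId b).hom.toNatTrans.app (act F u x) ≫ cell F γ x) ≫ cell F α.hom x =
    cell F β.hom (act F u x) ≫ push F w₂ ((F.mapId b).hom.toNatTrans.app (act F u x))
  rw [push_comp, push_mapId, push_mapId, push_cell, Category.assoc, Category.assoc, k',
    mapComp_inv_cell, cell_comp, cell_comp, Category.assoc, Category.assoc]
  exact cell_hom_inv_assoc (λ_ w₁) _ _

lemma transIso_cell {a b : A} {u v : a ⟶ b} (γ : u ⟶ v) (x : F.obj a) :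
    (ι F b).map ((F.map₂ γ).toNatTrans.app x) ≫ (transIso F v x).hom = (transIso F u x).hom := by
  refine (ofPremor_comp_same _ _).trans
    (Eq.trans (ofPremor_congr ?_) (ofPremor_eq (cell_homotopic γ x)))
  exact (F.mapId b).hom.toNatTrans.naturality ((F.map₂ γ).toNatTrans.app x)

end LL

/-- A pseudocone of the 2-functor `F` with vertex the category `X`. -/
@[ext]
structure PseudoCone (F : A ⥤ᵖ Cat.{v₂, u₂}) (X : Type u₃) [Category.{v₃} X] where
  /-- The functors `h_A : F A ⥤ X`. -/
  leg (a : A) : F.obj a ⥤ X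
  /-- The invertible natural transformations `h_u : h_B ∘ F(u) ≅ h_A`. -/
  tr {a b : A} (u : a ⟶ b) : (F.map u).toFunctor ⋙ leg b ≅ leg a
  /-- `h_id = id`; the right-hand side is an identity when `F` is a 2-functor. -/
  tr_id (a : A) (x : F.obj a) :
    (tr (𝟙 a)).hom.app x = (leg a).map ((F.mapId a).hom.toNatTrans.app x)
  /-- `h_{vu} = h_u ∘ (h_v F(u))`; the first factor is an identity when `F` is a 2-functor. -/
  tr_comp {a b c : A} (u : a ⟶ b) (v : b ⟶ c) (x : F.obj a) :
    (tr (u ≫ v)).hom.app x = (leg c).map ((F.mapComp u v).hom.toNatTrans.app x) ≫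
      (tr v).hom.app ((F.map u).toFunctor.obj x) ≫ (tr u).hom.app x
  /-- `h_v ∘ (h_B F(γ)) = h_u` for every 2-cell `γ : u ⟶ v`. -/
  tr_cell {a b : A} {u v : a ⟶ b} (γ : u ⟶ v) (x : F.obj a) :
    (leg b).map ((F.map₂ γ).toNatTrans.app x) ≫ (tr v).hom.app x = (tr u).hom.app x

namespace PseudoCone

variable {X : Type u₃} [Category.{v₃} X] {Z : Type u₄} [Category.{v₄} Z]

/-- A morphism of pseudocones with the same vertex: a modification. -/
@[ext]
structure Hom (h l : PseudoCone F X) where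
  /-- The natural transformations `φ_A : h_A ⟶ l_A`. -/
  app (a : A) : h.leg a ⟶ l.leg a
  /-- `φ_A ∘ h_u = l_u ∘ (φ_B F(u))`. -/
  comm {a b : A} (u : a ⟶ b) (x : F.obj a) :
    (h.tr u).hom.app x ≫ (app a).app x =
      (app b).app ((F.map u).toFunctor.obj x) ≫ (l.tr u).hom.app x

/-- The category `PC[F, X]` of pseudocones of `F` with vertex `X`. -/
instance : Category (PseudoCone F X) where
  Hom := Hom
  id h := { app := fun a => 𝟙 (h.leg a), comm := by simp }
  comp φ ψ :=
    { app := fun a => φ.app a ≫ ψ.app a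
      comm := fun u x => by
        simp only [NatTrans.comp_app, Category.assoc]
        rw [← ψ.comm u x, ← Category.assoc, φ.comm u x, Category.assoc] }
  id_comp φ := Hom.ext (funext fun a => Category.id_comp (φ.app a))
  comp_id φ := Hom.ext (funext fun a => Category.comp_id (φ.app a))
  assoc φ ψ χ := Hom.ext (funext fun a => Category.assoc (φ.app a) (ψ.app a) (χ.app a))

/-- The composite of a pseudocone with vertex `Z` and a functor `Z ⥤ X`. -/
def postcomp (h : PseudoCone F Z) (s : Z ⥤ X) : PseudoCone F X where
  leg a := h.leg a ⋙ s
  tr u := (Functor.associator _ _ _).symm ≪≫ Functor.isoWhiskerRight (h.tr u) s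
  tr_id a x := by simp [h.tr_id]
  tr_comp u v x := by simp [h.tr_comp]
  tr_cell γ x := by simp [← h.tr_cell γ x]

variable (X) in
/-- Composition with a pseudocone `h` with vertex `Z`, as a functor `Cat[Z, X] ⥤ PC[F, X]`. -/
def compFunctor (h : PseudoCone F Z) : (Z ⥤ X) ⥤ PseudoCone F X where
  obj s := h.postcomp s
  map θ := { app := fun a => Functor.whiskerLeft (h.leg a) θ, comm := by simp [postcomp] }
  map_id s := Hom.ext (funext fun a => Functor.whiskerLeft_id _)
  map_comp θ η := Hom.ext (funext fun a => Functor.whiskerLeft_comp _ θ η)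

variable (F X) in
/-- The pseudocones all of whose functors preserve finite limits. -/
def leftExact : ObjectProperty (PseudoCone F X) :=
  fun h => ∀ a : A, PreservesFiniteLimits (h.leg a)

end PseudoCone

/-- The category `PC_fl[F, X]` of pseudocones in the 2-category of finitely complete categories and
finite limit preserving functors: a full subcategory of `PC[F, X]`, since that 2-category has all
natural transformations as its 2-cells. -/
abbrev PseudoConeFl (F : A ⥤ᵖ Cat.{v₂, u₂}) (X : Type u₃) [Category.{v₃} X] :=
  (PseudoCone.leftExact F X).FullSubcategory

/-- Composition with a left exact pseudocone `h` with vertex `Z`, as a functor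
`Cat_fl[Z, X] ⥤ PC_fl[F, X]`; here `Z ⥤ₗ X` is the category of finite limit preserving functors
and all natural transformations between them. -/
def PseudoConeFl.compFunctor {Z : Type u₄} [Category.{v₄} Z] (h : PseudoConeFl F Z)
    (X : Type u₃) [Category.{v₃} X] : (Z ⥤ₗ X) ⥤ PseudoConeFl F X :=
  (PseudoCone.leftExact F X).lift (LeftExactFunctor.forget Z X ⋙ h.obj.compFunctor X)
    (fun s a =>
      haveI := h.property a
      haveI : PreservesFiniteLimits s.obj := s.property
      comp_preservesFiniteLimits (h.obj.leg a) s.obj)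

variable (F) in
/-- The pseudocone `λ` of `F` with vertex `L(F)`. -/
noncomputable def LL.cone [PreTwoFiltered A] : PseudoCone F (LL F) where
  leg := LL.ι F
  tr := LL.ιTrans F
  tr_id := LL.transIso_id
  tr_comp := LL.transIso_comp
  tr_cell := LL.transIso_cell

end LLConstruction

/-! `LL F` behaves like a filtered colimit of categories: finite data in it live at a single stage
`F C`, and an equality between such data already holds at a later stage. A morphism factors as an
inverse `λ_u`, an arrow `λ_C(ξ)` and a `λ_v` (`ofPremor_eq_ι`). FF1 brings two parallel morphisms to
the same 1-cells (`exists_ofPremor_pair`); F2 and BF2 then turn equivalence of premorphisms with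
equal 1-cells into equality after one push (`exists_push_eq`).

Consequently a terminal object or a pullback square of `F B` that every `F(v)` preserves stays one
under `λ_B` (`nonempty_isTerminal_ι`, `isPullback_map_ι`): cones are factored at a finite stage, and
uniqueness is checked there. By F1 every cospan of `LL F` is isomorphic to the image of a cospan of
some `F D` (`exists_isPullback_iso`). This yields finite limits in `LL F`, and shows that a functor
on `LL F` is left exact as soon as its composites with all `λ_A` are.

For the universal property, the factorization forces the functor induced by a pseudocone `h` to send
`[(u, ξ, v)]` to `h_u⁻¹`, then `h_C(ξ)`, then `h_v`; the pseudocone axioms say exactly that this is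
well defined. Since every object is literally some `λ_A(x)` and the `λ_A(g)`, `λ_u` generate all
morphisms, restriction along `λ` is bijective on objects and fully faithful, hence an isomorphism
and not merely an equivalence. -/

namespace LLConstruction

variable {A : Type u₁} [Bicategory.{w₁, v₁} A] {F : A ⥤ᵖ Cat.{v₂, u₂}}
  {X : Type u₃} [Category.{v₃} X]

/-! ### Representatives of morphisms and equalities at a finite stage -/

namespace LL

section PreTwoFiltered

variable [PreTwoFiltered A]

/-- Every morphism of `L(F)` is, up to the isomorphisms `λ_u`, in the image of some `λ_C`. -/
lemma ofPremor_eq_ι {a b c : A} {x : F.obj a} {y : F.obj b} (u : a ⟶ c) (v : b ⟶ c)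
    (ξ : act F u x ⟶ act F v y) :
    ofPremor (x := ⟨a, x⟩) (y := ⟨b, y⟩) ⟨c, u, v, ξ⟩ =
      (transIso F u x).inv ≫ (ι F c).map ξ ≫ (transIso F v y).hom := by
  refine Eq.symm ((congrArg (_ ≫ ·) (ofPremor_comp_same _ _)).trans
    ((ofPremor_comp_same _ _).trans (ofPremor_congr ?_)))
  have n : (F.map (𝟙 c)).toFunctor.map ξ ≫ (F.mapId c).hom.toNatTrans.app _ =
    (F.mapId c).hom.toNatTrans.app _ ≫ ξ := (F.mapId c).hom.toNatTrans.naturality ξ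
  exact (Iso.inv_comp_eq ((Cat.Hom.toNatIso (F.mapId c)).app (act F u x))).2 n

lemma ofPremor_comp_ι {a b c : A} {x : F.obj a} {y y' : F.obj b} (u : a ⟶ c) (v : b ⟶ c)
    (ξ : act F u x ⟶ act F v y) (f : y ⟶ y') :
    ofPremor (x := ⟨a, x⟩) (y := ⟨b, y⟩) ⟨c, u, v, ξ⟩ ≫ (ι F b).map f =
      ofPremor ⟨c, u, v, ξ ≫ (F.map v).toFunctor.map f⟩ := by
  rw [ι_map_eq f v]
  exact ofPremor_comp_same _ _

lemma ofPremor_push {a b c d : A} {x : F.obj a} {y : F.obj b} (u : a ⟶ c) (v : b ⟶ c)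
    (ξ : act F u x ⟶ act F v y) (w : c ⟶ d) :
    ofPremor (x := ⟨a, x⟩) (y := ⟨b, y⟩) ⟨c, u, v, ξ⟩ =
      ofPremor ⟨d, u ≫ w, v ≫ w, push F w ξ⟩ :=
  ofPremor_eq (Premor.Homotopic.of_push (x := ⟨a, x⟩) (y := ⟨b, y⟩) w ξ)

/-- Parallel 2-cells being equalized, two premorphisms with the same 1-cells are equivalent only
if they become equal after pushing forward along a 1-cell. -/
lemma exists_push_eq (hA : EqualizesTwoCells A) {a b c : A} {x : F.obj a} {y : F.obj b}
    {u : a ⟶ c} {v : b ⟶ c} {ξ ξ' : act F u x ⟶ act F v y}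
    (h : ofPremor (x := ⟨a, x⟩) (y := ⟨b, y⟩) ⟨c, u, v, ξ⟩ = ofPremor ⟨c, u, v, ξ'⟩) :
    ∃ (d : A) (w : c ⟶ d), push F w ξ = push F w ξ' := by
  obtain ⟨c', w₁, w₂, α, β, (e : Square β.hom (push F w₁ ξ) α.hom (push F w₂ ξ'))⟩ :
    Premor.Homotopic (x := (⟨a, x⟩ : LL F)) (y := (⟨b, y⟩ : LL F)) ⟨c, u, v, ξ⟩ ⟨c, u, v, ξ'⟩ :=
    Quotient.exact h
  dsimp only at w₁ w₂ α β e
  -- F2 against an identity 2-cell: after whiskering with `p₁`, the 2-cell `α` becomes `v ◁ θ` for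
  -- an invertible `θ : w₁ ≫ p₁ ≅ w₂ ≫ p₁`.
  obtain ⟨d, p₁, p₂, α', β', k⟩ := PreTwoFiltered.F2 α.hom (𝟙 (v ≫ w₁))
  have k' : (α_ v w₁ p₁).inv ≫ α.hom ▷ p₁ ≫ (α_ v w₂ p₁).hom =
      v ◁ (β'.hom ≫ α'.inv) := by
    have k₂ := (α_ v w₁ p₁).inv ≫= k =≫ ((α_ v w₁ p₂).hom ≫ v ◁ α'.inv)
    simpa [← whiskerLeft_comp] using k₂
  have s := (Square.assoc w₁ p₁ ξ).inv.comp
    ((e.whisker p₁).comp (Square.assoc w₂ p₁ ξ'))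
  rw [k'] at s
  -- Naturality along the inverse of `θ` makes the target side of the square an identity and the
  -- source side an endo-2-cell, which BF2 identifies with the identity.
  have s' := s.comp (Square.nat (α'.hom ≫ β'.inv) ξ')
  have k₃ : v ◁ (β'.hom ≫ α'.inv) ≫ v ◁ (α'.hom ≫ β'.inv) = 𝟙 _ := by
    simp [← whiskerLeft_comp]
  rw [k₃] at s'
  obtain ⟨d', q, hq⟩ := hA (((α_ u w₁ p₁).inv ≫ β.hom ▷ p₁ ≫ (α_ u w₂ p₁).hom) ≫
    u ◁ (α'.hom ≫ β'.inv)) (𝟙 _)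
  have s₂ := s'.whisker q
  rw [hq] at s₂
  have s₃ : push F q (push F (w₁ ≫ p₁) ξ) = push F q (push F (w₁ ≫ p₁) ξ') := by
    simpa [Square, cell_id] using s₂
  refine ⟨d', (w₁ ≫ p₁) ≫ q, ?_⟩
  rw [push_push, push_push] at s₃
  have s₄ := cell F (α_ u (w₁ ≫ p₁) q).inv x ≫= s₃ =≫ cell F (α_ v (w₁ ≫ p₁) q).hom y
  simpa only [Category.assoc, cell_inv_hom_assoc, cell_inv_hom, Category.comp_id] using s₄

end PreTwoFiltered

/-- Two morphisms between objects over `a` and `b` have representatives with the same 1-cells. -/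
lemma exists_ofPremor_pair [PseudoTwoFiltered A] {a b : A} {x x' : F.obj a} {y y' : F.obj b}
    (f : (⟨a, x⟩ : LL F) ⟶ ⟨b, y⟩) (g : (⟨a, x'⟩ : LL F) ⟶ ⟨b, y'⟩) :
    ∃ (c : A) (u : a ⟶ c) (v : b ⟶ c) (ξ : act F u x ⟶ act F v y)
      (ζ : act F u x' ⟶ act F v y'), f = ofPremor ⟨c, u, v, ξ⟩ ∧ g = ofPremor ⟨c, u, v, ζ⟩ := by
  obtain ⟨⟨c₁, u₁, v₁, ξ⟩, rfl⟩ := ofPremor_surj f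
  obtain ⟨⟨c₂, u₂, v₂, ζ⟩, rfl⟩ := ofPremor_surj g
  dsimp only at u₁ v₁ ξ u₂ v₂ ζ
  -- The spans out of `a` and out of `b` must be completed by the same `p`, `q`, which is what FF1
  -- adds to F1. The second representative is then conjugated by `β` and `α`.
  obtain ⟨c, p, q, ⟨β⟩, ⟨α⟩⟩ := PseudoTwoFiltered.FF1 u₁ u₂ v₁ v₂
  refine ⟨c, u₁ ≫ p, v₁ ≫ p, push F p ξ, cell F β.hom x' ≫ push F q ζ ≫ cell F α.inv y',
    ofPremor_push _ _ _ _, (ofPremor_push _ _ _ q).trans ?_⟩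
  refine ofPremor_eq (Premor.Homotopic.of_square β.symm α.symm ?_)
  simp [Square, cell_inv_hom_assoc]

/-! ### Finite limits in `LL F` -/

/-- Only the two 1-cells out of the base of `z` have to be reconciled, so F1 suffices: both
representatives are pushed to a common stage, the second is corrected by the 2-cell, and the
pullback is taken there. -/
lemma exists_isPullback_iso [PreTwoFiltered A] [∀ a : A, HasPullbacks (F.obj a)] {x y z : LL F}
    (f : x ⟶ z) (g : y ⟶ z) :
    ∃ (d : A) (p x' y' z' : F.obj d) (fst : p ⟶ x') (snd : p ⟶ y') (f' : x' ⟶ z') (g' : y' ⟶ z')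
      (i : (ι F d).obj x' ≅ x) (j : (ι F d).obj y' ≅ y) (k : (ι F d).obj z' ≅ z),
      IsPullback fst snd f' g' ∧ (ι F d).map f' ≫ k.hom = i.hom ≫ f ∧
        (ι F d).map g' ≫ k.hom = j.hom ≫ g := by
  obtain ⟨⟨c₁, u₁, v₁, ξ⟩, rfl⟩ := ofPremor_surj f
  obtain ⟨⟨c₂, u₂, v₂, ζ⟩, rfl⟩ := ofPremor_surj g
  obtain ⟨d, s, t, ⟨γ⟩⟩ := PreTwoFiltered.F1 v₁ v₂
  refine ⟨d, _, _, _, _, _, _, push F s ξ, push F t ζ ≫ cell F γ.inv z.pt,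
    transIso F (u₁ ≫ s) x.pt, transIso F (u₂ ≫ t) y.pt, transIso F (v₁ ≫ s) z.pt,
    IsPullback.of_hasPullback _ _, ?_, ?_⟩
  · refine ((Iso.inv_comp_eq _).1 ?_)
    exact (ofPremor_eq_ι _ _ _).symm.trans (ofPremor_push u₁ v₁ ξ s).symm
  · refine ((Iso.inv_comp_eq _).1 ?_)
    refine (ofPremor_eq_ι _ _ _).symm.trans (Eq.trans ?_ (ofPremor_push u₂ v₂ ζ t).symm)
    refine ofPremor_eq (Premor.Homotopic.of_square (Iso.refl _) γ ?_)
    simp [Square, cell_inv_hom, cell_id]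

lemma push_comp_map {a b c d : A} {x : F.obj a} {y y' : F.obj b} {u : a ⟶ c} {v : b ⟶ c}
    (w : c ⟶ d) (ξ : act F u x ⟶ act F v y) (f : y ⟶ y') :
    push F w (ξ ≫ (F.map v).toFunctor.map f) = push F w ξ ≫ (F.map (v ≫ w)).toFunctor.map f := by
  rw [push_comp, push_map]

/-- Equality of two morphisms after composition with `λ_B(f)` holds at a finite stage. -/
lemma exists_push_comp_eq [PreTwoFiltered A] (hA : EqualizesTwoCells A) {a b c : A}
    {x : F.obj a} {y y' z : F.obj b} {u : a ⟶ c} {v : b ⟶ c}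
    {ξ : act F u x ⟶ act F v y} {ζ : act F u x ⟶ act F v y'} {f : y ⟶ z} {g : y' ⟶ z}
    (h : ofPremor (x := ⟨a, x⟩) (y := ⟨b, y⟩) ⟨c, u, v, ξ⟩ ≫ (ι F b).map f =
      ofPremor (x := ⟨a, x⟩) (y := ⟨b, y'⟩) ⟨c, u, v, ζ⟩ ≫ (ι F b).map g) :
    ∃ (d : A) (w : c ⟶ d), push F w ξ ≫ (F.map (v ≫ w)).toFunctor.map f =
      push F w ζ ≫ (F.map (v ≫ w)).toFunctor.map g := by
  obtain ⟨d, w, e⟩ := exists_push_eq hA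
    ((ofPremor_comp_ι _ _ _ _).symm.trans (h.trans (ofPremor_comp_ι _ _ _ _)))
  exact ⟨d, w, (push_comp_map w ξ f).symm.trans (e.trans (push_comp_map w ζ g))⟩

/-- A pair of morphisms `f`, `g` such that all `F(v)(f)`, `F(v)(g)` are jointly monic is sent by
`λ_B` to a jointly monic pair. -/
lemma hom_ext_ι [PseudoTwoFiltered A] (hA : EqualizesTwoCells A) {x : LL F} {b : A}
    {p y y' : F.obj b} (fst : p ⟶ y) (snd : p ⟶ y')
    (h : ∀ {c : A} (v : b ⟶ c) {q : F.obj c} (k l : q ⟶ act F v p),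
      k ≫ (F.map v).toFunctor.map fst = l ≫ (F.map v).toFunctor.map fst →
      k ≫ (F.map v).toFunctor.map snd = l ≫ (F.map v).toFunctor.map snd → k = l)
    {f g : x ⟶ (ι F b).obj p} (h₁ : f ≫ (ι F b).map fst = g ≫ (ι F b).map fst)
    (h₂ : f ≫ (ι F b).map snd = g ≫ (ι F b).map snd) : f = g := by
  obtain ⟨a, x⟩ := x
  obtain ⟨c, u, v, ξ, ζ, rfl, rfl⟩ := exists_ofPremor_pair (y := p) (y' := p) f g
  obtain ⟨d, w, e₁⟩ := exists_push_comp_eq hA h₁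
  -- The two equalities are realized one after the other; the first survives the second push.
  rw [ofPremor_push u v ξ w, ofPremor_push u v ζ w] at h₂ ⊢
  obtain ⟨d', w', e₂⟩ := exists_push_comp_eq hA h₂
  have e₁' := congrArg (push F w') e₁
  rw [push_comp_map, push_comp_map] at e₁'
  rw [ofPremor_push _ _ _ w', ofPremor_push _ _ (push F w ζ) w', h _ _ _ e₁' e₂]

/-- The functors `λ_A` preserve those pullback squares that all `F(v)` preserve. -/
lemma isPullback_map_ι [PseudoTwoFiltered A] (hA : EqualizesTwoCells A) {b : A}
    {p x y z : F.obj b} {fst : p ⟶ x} {snd : p ⟶ y} {f : x ⟶ z} {g : y ⟶ z}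
    (h : ∀ {c : A} (v : b ⟶ c), IsPullback ((F.map v).toFunctor.map fst)
      ((F.map v).toFunctor.map snd) ((F.map v).toFunctor.map f) ((F.map v).toFunctor.map g))
    (w : fst ≫ f = snd ≫ g) :
    IsPullback ((ι F b).map fst) ((ι F b).map snd) ((ι F b).map f) ((ι F b).map g) := by
  have key : ∀ (q : LL F) (k : q ⟶ (ι F b).obj x) (l : q ⟶ (ι F b).obj y),
      k ≫ (ι F b).map f = l ≫ (ι F b).map g →
      ∃ m : q ⟶ (ι F b).obj p, m ≫ (ι F b).map fst = k ∧ m ≫ (ι F b).map snd = l := by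
    rintro ⟨a, q⟩ k l e
    obtain ⟨c, u, v, ξ, ζ, rfl, rfl⟩ := exists_ofPremor_pair (y := x) (y' := y) k l
    obtain ⟨d, r, e'⟩ := exists_push_comp_eq hA e
    -- At stage `d` the cone commutes strictly, so it factors through the `F(v ≫ r)`-image of the
    -- given square.
    refine ⟨ofPremor ⟨d, u ≫ r, v ≫ r, (h (v ≫ r)).lift _ _ e'⟩,
      (ofPremor_comp_ι _ _ _ _).trans (Eq.trans ?_ (ofPremor_push u v ξ r).symm),
      (ofPremor_comp_ι _ _ _ _).trans (Eq.trans ?_ (ofPremor_push u v ζ r).symm)⟩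
    · exact ofPremor_congr ((h (v ≫ r)).lift_fst _ _ e')
    · exact ofPremor_congr ((h (v ≫ r)).lift_snd _ _ e')
  refine ⟨⟨by rw [← Functor.map_comp, w, Functor.map_comp]⟩, ⟨PullbackCone.IsLimit.mk _
    (fun s => (key s.pt s.fst s.snd s.condition).choose)
    (fun s => (key s.pt s.fst s.snd s.condition).choose_spec.1)
    (fun s => (key s.pt s.fst s.snd s.condition).choose_spec.2) fun s m h₁ h₂ => ?_⟩⟩
  have hs := (key s.pt s.fst s.snd s.condition).choose_spec
  exact hom_ext_ι hA fst snd (fun v _ k l => (h v).hom_ext) (h₁.trans hs.1.symm)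
    (h₂.trans hs.2.symm)

/-- The functors `λ_A` preserve those terminal objects that all `F(v)` preserve. -/
lemma nonempty_isTerminal_ι [TwoFiltered A] {b : A} {t : F.obj b}
    (h : ∀ {c : A} (v : b ⟶ c), Nonempty (IsTerminal (act F v t))) :
    Nonempty (IsTerminal ((ι F b).obj t)) := by
  have (x : LL F) : Nonempty (Unique (x ⟶ (ι F b).obj t)) := by
    obtain ⟨a, x⟩ := x
    obtain ⟨c, ⟨u⟩, ⟨v⟩⟩ := TwoFiltered.F0 a b
    refine ⟨⟨⟨ofPremor ⟨c, u, v, (h v).some.from _⟩⟩, fun f => ?_⟩⟩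
    -- With equal 1-cells, both representatives are arrows into the terminal object `F(v')(t)`,
    -- hence equal.
    obtain ⟨d, u', v', ξ, ζ, rfl, e⟩ := exists_ofPremor_pair (y := t) (y' := t) f
      (ofPremor ⟨c, u, v, (h v).some.from _⟩)
    exact (ofPremor_congr ((h v').some.hom_ext _ _)).trans e.symm
  exact ⟨IsTerminal.ofUniqueHom (fun x => (this x).some.default) fun x m => (this x).some.uniq m⟩

/-- The terminal object comes from any one stage, which exists since `A` is non-empty; the pullback
of a cospan comes from the stage where the cospan is represented. -/
lemma hasFiniteLimits [TwoFiltered A] (hA : EqualizesTwoCells A)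
    [∀ a : A, HasFiniteLimits (F.obj a)]
    [∀ {a b : A} (u : a ⟶ b), PreservesFiniteLimits (F.map u).toFunctor] :
    HasFiniteLimits (LL F) := by
  have : HasTerminal (LL F) := by
    obtain ⟨a⟩ := TwoFiltered.nonempty (A := A)
    exact (nonempty_isTerminal_ι (F := F) (b := a) (t := ⊤_ _) fun v =>
      ⟨terminalIsTerminal.isTerminalObj (F.map v).toFunctor _⟩).some.hasTerminal
  have : HasPullbacks (LL F) := by
    have {x y z : LL F} (f : x ⟶ z) (g : y ⟶ z) : HasPullback f g := by
      obtain ⟨d, p, x', y', z', fst, snd, f', g', i, j, k, h, hf, hg⟩ :=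
        exists_isPullback_iso f g
      exact ((isPullback_map_ι hA (fun v => h.map (F.map v).toFunctor) h.w).of_iso
        (Iso.refl _) i j k (Category.id_comp (_ ≫ _)).symm (Category.id_comp (_ ≫ _)).symm
          hf hg).hasPullback
    exact hasPullbacks_of_hasLimit_cospan _
  exact hasFiniteLimits_of_hasTerminal_and_pullbacks

lemma preservesFiniteLimits_ι [TwoFiltered A] (hA : EqualizesTwoCells A)
    [∀ a : A, HasFiniteLimits (F.obj a)]
    [∀ {a b : A} (u : a ⟶ b), PreservesFiniteLimits (F.map u).toFunctor] (a : A) :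
    PreservesFiniteLimits (ι F a) := by
  have : PreservesLimit (Functor.empty.{0} _) (ι F a) :=
    preservesLimit_of_preserves_limit_cone terminalIsTerminal
      ((isLimitMapConeEmptyConeEquiv _ _).symm (nonempty_isTerminal_ι fun v =>
        ⟨terminalIsTerminal.isTerminalObj (F.map v).toFunctor _⟩).some)
  have := preservesLimitsOfShape_pempty_of_preservesTerminal (ι F a)
  have : PreservesLimitsOfShape WalkingCospan (ι F a) :=
    preservesLimitsOfShape_walkingCospan_of_forall_isPullback fun x y z f g _ =>
      ⟨_, _, _, IsPullback.of_hasPullback f g, isPullback_map_ι hA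
        (fun v => (IsPullback.of_hasPullback f g).map (F.map v).toFunctor) pullback.condition⟩
  exact preservesFiniteLimits_of_preservesTerminal_and_pullbacks _

/-- It suffices to treat one limit cone for the terminal object and one for each cospan, and these
can be taken in the image of some `λ_A` up to isomorphism. This makes the functor induced by a left
exact pseudocone left exact. -/
lemma preservesFiniteLimits_of_ι [TwoFiltered A] (hA : EqualizesTwoCells A)
    [∀ a : A, HasFiniteLimits (F.obj a)]
    [∀ {a b : A} (u : a ⟶ b), PreservesFiniteLimits (F.map u).toFunctor]
    (s : LL F ⥤ X) [∀ a : A, PreservesFiniteLimits (ι F a ⋙ s)] : PreservesFiniteLimits s := by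
  have := hasFiniteLimits (F := F) hA
  have := preservesFiniteLimits_ι (F := F) hA
  have : PreservesLimit (Functor.empty.{0} _) s := by
    obtain ⟨a⟩ := TwoFiltered.nonempty (A := A)
    exact preservesLimit_of_preserves_limit_cone
      (terminalIsTerminal.isTerminalObj (ι F a) (⊤_ _))
      ((isLimitMapConeEmptyConeEquiv _ _).symm
        (terminalIsTerminal.isTerminalObj (ι F a ⋙ s) (⊤_ _)))
  have := preservesLimitsOfShape_pempty_of_preservesTerminal s
  have : PreservesLimitsOfShape WalkingCospan s :=
    preservesLimitsOfShape_walkingCospan_of_forall_isPullback fun x y z f g _ => by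
      obtain ⟨d, p, x', y', z', fst, snd, f', g', i, j, k, h, hf, hg⟩ :=
        exists_isPullback_iso f g
      refine ⟨_, (ι F d).map fst ≫ i.hom, (ι F d).map snd ≫ j.hom,
        (h.map (ι F d)).of_iso (Iso.refl _) i j k (Category.id_comp _).symm
          (Category.id_comp _).symm hf hg,
        (h.map (ι F d ⋙ s)).of_iso (Iso.refl _) (s.mapIso i) (s.mapIso j) (s.mapIso k)
          ((s.map_comp _ _).symm.trans (Category.id_comp _).symm)
          ((s.map_comp _ _).symm.trans (Category.id_comp _).symm) ?_ ?_⟩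
      · simp only [Functor.comp_map, Functor.mapIso_hom, ← Functor.map_comp, hf]
      · simp only [Functor.comp_map, Functor.mapIso_hom, ← Functor.map_comp, hg]
  exact preservesFiniteLimits_of_preservesTerminal_and_pullbacks _

/-- Naturality of a family of morphisms between functors on `L(F)` may be checked on the morphisms
in the image of the `λ_A` and on the isomorphisms `λ_u`. -/
lemma naturality_of_ι [PreTwoFiltered A] {s t : LL F ⥤ X} (ψ : ∀ x, s.obj x ⟶ t.obj x)
    (h₁ : ∀ {a : A} {x y : F.obj a} (g : x ⟶ y),
      s.map ((ι F a).map g) ≫ ψ ⟨a, y⟩ = ψ ⟨a, x⟩ ≫ t.map ((ι F a).map g))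
    (h₂ : ∀ {a b : A} (u : a ⟶ b) (x : F.obj a),
      s.map (transIso F u x).hom ≫ ψ ⟨a, x⟩ = ψ ⟨b, _⟩ ≫ t.map (transIso F u x).hom)
    {x y : LL F} (f : x ⟶ y) : s.map f ≫ ψ y = ψ x ≫ t.map f := by
  -- The morphisms at which `ψ` is natural are closed under composition and under inverses, so the
  -- factorization of a premorphism applies.
  have hcomp {x y z : LL F} {f : x ⟶ y} {g : y ⟶ z} (hf : s.map f ≫ ψ y = ψ x ≫ t.map f)
      (hg : s.map g ≫ ψ z = ψ y ≫ t.map g) : s.map (f ≫ g) ≫ ψ z = ψ x ≫ t.map (f ≫ g) := by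
    rw [Functor.map_comp, Category.assoc, hg, reassoc_of% hf, Functor.map_comp]
  have hinv {x y : LL F} (i : x ≅ y) (hi : s.map i.hom ≫ ψ y = ψ x ≫ t.map i.hom) :
      s.map i.inv ≫ ψ x = ψ y ≫ t.map i.inv := by
    rw [← cancel_epi (s.map i.hom), reassoc_of% hi, ← Functor.map_comp_assoc, ← Functor.map_comp]
    simp
  obtain ⟨⟨c, u, v, ξ⟩, rfl⟩ := ofPremor_surj f
  rw [ofPremor_eq_ι]
  exact hcomp (hinv _ (h₂ u x.pt)) (hcomp (h₁ ξ) (h₂ v y.pt))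

end LL

/-! ### The functor induced by a pseudocone -/

namespace PseudoCone

/-- The action on premorphisms of the functor induced by a pseudocone. -/
def descPremor (h : PseudoCone F X) {x y : LL F} (f : Premor x y) :
    (h.leg x.base).obj x.pt ⟶ (h.leg y.base).obj y.pt :=
  (h.tr f.u).inv.app x.pt ≫ (h.leg f.apex).map f.ξ ≫ (h.tr f.v).hom.app y.pt

lemma tr_cell_inv (h : PseudoCone F X) {a b : A} {u v : a ⟶ b} (γ : u ⟶ v) (x : F.obj a) :
    (h.tr u).inv.app x ≫ (h.leg b).map (cell F γ x) = (h.tr v).inv.app x := by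
  have := (h.tr u).inv.app x ≫= h.tr_cell γ x =≫ (h.tr v).inv.app x
  simpa using this

lemma tr_comp_inv (h : PseudoCone F X) {a b c : A} (u : a ⟶ b) (v : b ⟶ c) (x : F.obj a) :
    (h.tr (u ≫ v)).inv.app x = (h.tr u).inv.app x ≫
      (h.tr v).inv.app ((F.map u).toFunctor.obj x) ≫
        (h.leg c).map ((F.mapComp u v).inv.toNatTrans.app x) := by
  rw [← cancel_epi ((h.tr (u ≫ v)).hom.app x), Iso.hom_inv_id_app, h.tr_comp]
  simp [← Functor.map_comp]

/-- Two moves generate homotopy: changing 1-cells by invertible 2-cells is absorbed by `tr_cell`,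
and pushing along `w` by `tr_comp` and the naturality of `h_w`. -/
lemma descPremor_congr (h : PseudoCone F X) {x y : LL F} {f g : Premor x y}
    (H : Premor.Homotopic f g) : h.descPremor f = h.descPremor g := by
  refine H.lift_eq _ ?_ ?_
  · intro c u u' v v' β α ξ ξ' e
    have e' := congrArg (h.leg c).map e
    simp only [Functor.map_comp] at e'
    simp only [descPremor]
    rw [← h.tr_cell α.hom, reassoc_of% e', ← h.tr_cell_inv β.hom, Category.assoc]
  · intro c d u v w ξ
    have n : (h.leg d).map ((F.map w).toFunctor.map ξ) ≫ (h.tr w).hom.app (act F v y.pt) =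
      (h.tr w).hom.app (act F u x.pt) ≫ (h.leg c).map ξ := (h.tr w).hom.naturality ξ
    have m (v : y.base ⟶ c) : (h.leg d).map ((F.mapComp v w).inv.toNatTrans.app y.pt) ≫
        (h.tr (v ≫ w)).hom.app y.pt = (h.tr w).hom.app (act F v y.pt) ≫ (h.tr v).hom.app y.pt := by
      rw [h.tr_comp, ← Functor.map_comp_assoc]
      simp
    have m' (u : x.base ⟶ c) : (h.tr (u ≫ w)).inv.app x.pt ≫
        (h.leg d).map ((F.mapComp u w).hom.toNatTrans.app x.pt) =
          (h.tr u).inv.app x.pt ≫ (h.tr w).inv.app (act F u x.pt) := by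
      rw [h.tr_comp_inv, Category.assoc, Category.assoc, ← Functor.map_comp]
      simp
    simp only [descPremor, push, Functor.map_comp, Category.assoc, m]
    rw [reassoc_of% m', reassoc_of% n]
    simp

lemma descPremor_comp_same (h : PseudoCone F X) {x y z : LL F} {c : A} {u : x.base ⟶ c}
    {v : y.base ⟶ c} {r : z.base ⟶ c} (ξ : act F u x.pt ⟶ act F v y.pt)
    (ζ : act F v y.pt ⟶ act F r z.pt) :
    h.descPremor ⟨c, u, v, ξ⟩ ≫ h.descPremor ⟨c, v, r, ζ⟩ = h.descPremor ⟨c, u, r, ξ ≫ ζ⟩ := by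
  simp [descPremor]

/-- Used to get strict equality of pseudocones; the transition isomorphisms have types depending on
the legs, hence the `eqToHom`s. -/
lemma ext_of_app {h l : PseudoCone F X} (e : ∀ a, h.leg a = l.leg a)
    (e' : ∀ {a b : A} (u : a ⟶ b) (x : F.obj a), (h.tr u).hom.app x =
      eqToHom (Functor.congr_obj (e b) _) ≫ (l.tr u).hom.app x ≫
        eqToHom (Functor.congr_obj (e a).symm x)) : h = l := by
  obtain ⟨leg, tr, _, _, _⟩ := h
  obtain ⟨leg', tr', _, _, _⟩ := l
  obtain rfl : leg = leg' := funext e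
  obtain rfl : @tr = @tr' := by
    funext a b u
    ext x
    simpa using e' u x
  rfl

lemma tr_app_of_eq {h l : PseudoCone F X} (e : h = l) {a b : A} (u : a ⟶ b) (x : F.obj a) :
    (h.tr u).hom.app x = eqToHom (by rw [e]) ≫ (l.tr u).hom.app x ≫ eqToHom (by rw [e]) := by
  subst e
  simp

variable [PreTwoFiltered A]

/-- The functor `L(F) ⥤ X` induced by a pseudocone with vertex `X`. -/
noncomputable def desc (h : PseudoCone F X) : LL F ⥤ X where
  obj x := (h.leg x.base).obj x.pt
  map {x y} f := Quotient.lift (s := Premor.setoid x y) h.descPremor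
    (fun _ _ => h.descPremor_congr) f
  map_id x := by
    change h.descPremor (LL.idPremor x) = _
    refine (congrArg (fun k => (h.tr (𝟙 x.base)).inv.app x.pt ≫ k ≫ (h.tr (𝟙 x.base)).hom.app x.pt)
      ((h.leg x.base).map_id _)).trans ?_
    exact (congrArg (_ ≫ ·) (Category.id_comp _)).trans ((h.tr (𝟙 x.base)).inv_hom_id_app x.pt)
  map_comp {x y z} f g := by
    obtain ⟨⟨c₁, u₁, v₁, ξ⟩, rfl⟩ := LL.ofPremor_surj f
    obtain ⟨⟨c₂, u₂, v₂, ζ⟩, rfl⟩ := LL.ofPremor_surj g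
    obtain ⟨d, s, t, ⟨γ⟩⟩ := PreTwoFiltered.F1 v₁ u₂
    rw [LL.ofPremor_comp _ _ s t γ]
    change h.descPremor _ = h.descPremor _ ≫ h.descPremor _
    -- Both factors are moved to the apex `d`, and `γ` is absorbed into the first so that the middle
    -- 1-cells coincide; the inner transition isomorphisms then cancel.
    rw [h.descPremor_congr (Premor.Homotopic.of_push s ξ),
      h.descPremor_congr (Premor.Homotopic.of_push t ζ),
      h.descPremor_congr (Premor.Homotopic.of_square (u' := u₁ ≫ s) (v' := u₂ ≫ t)
        (ξ' := push F s ξ ≫ cell F γ.hom y.pt) (Iso.refl _) γ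
        (by simp [Square, cell_id])), descPremor_comp_same, Category.assoc]
    rfl

lemma desc_map_ofPremor (h : PseudoCone F X) {x y : LL F} (f : Premor x y) :
    h.desc.map (LL.ofPremor f) = h.descPremor f := rfl

lemma desc_map_ι (h : PseudoCone F X) {a : A} {x y : F.obj a} (f : x ⟶ y) :
    h.desc.map ((LL.ι F a).map f) = (h.leg a).map f := by
  refine (h.desc_map_ofPremor _).trans ?_
  have n : (h.leg a).map ((F.map (𝟙 a)).toFunctor.map f) ≫ (h.tr (𝟙 a)).hom.app y =
    (h.tr (𝟙 a)).hom.app x ≫ (h.leg a).map f := (h.tr (𝟙 a)).hom.naturality f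
  exact (congrArg (_ ≫ ·) n).trans (Iso.inv_hom_id_app_assoc _ _ _)

lemma desc_map_transIso (h : PseudoCone F X) {a b : A} (u : a ⟶ b) (x : F.obj a) :
    h.desc.map (LL.transIso F u x).hom = (h.tr u).hom.app x := by
  refine (h.desc_map_ofPremor _).trans ?_
  simp only [descPremor]
  -- The normalization `h_id = id` is what makes the induced functor recover `h_u` itself.
  rw [← h.tr_id b, Iso.inv_hom_id_app_assoc]

/-! ### Restriction along `λ` is an isomorphism of categories -/

lemma postcomp_tr_app (s : LL F ⥤ X) {a b : A} (u : a ⟶ b) (x : F.obj a) :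
    (((LL.cone F).postcomp s).tr u).hom.app x = s.map (LL.transIso F u x).hom :=
  Category.id_comp _

lemma postcomp_desc (h : PseudoCone F X) : (LL.cone F).postcomp h.desc = h := by
  refine ext_of_app (fun a => CategoryTheory.Functor.ext (fun x => rfl) fun x y f => ?_) fun u x => ?_
  · exact (h.desc_map_ι f).trans ((Category.id_comp _).trans (Category.comp_id _)).symm
  · exact (postcomp_tr_app h.desc u x).trans ((h.desc_map_transIso u x).trans
      ((Category.id_comp _).trans (Category.comp_id _)).symm)

/-- Injectivity on objects. Equality of the restrictions makes the family of `eqToHom`s natural at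
each `λ_A(g)` and each `λ_u`, hence everywhere. -/
lemma functor_ext_of_postcomp_eq {s t : LL F ⥤ X}
    (e : (LL.cone F).postcomp s = (LL.cone F).postcomp t) : s = t := by
  have e₀ : ∀ x, s.obj x = t.obj x := fun x => Functor.congr_obj congr(($e).leg x.base) x.pt
  refine CategoryTheory.Functor.ext e₀ fun x y f => ?_
  rw [← Category.assoc, ← comp_eqToHom_iff (e₀ y)]
  refine LL.naturality_of_ι (fun x => eqToHom (e₀ x)) (fun {a} x y g => ?_) (fun u x => ?_) f
  · exact (comp_eqToHom_iff (e₀ _) _ _).2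
      ((Functor.congr_hom congr(($e).leg a) g).trans (Category.assoc _ _ _).symm)
  · exact (comp_eqToHom_iff (e₀ _) _ _).2 ((postcomp_tr_app s u x).symm.trans
      ((tr_app_of_eq e u x).trans ((congrArg (_ ≫ · ≫ _) (postcomp_tr_app t u x)).trans
        (Category.assoc _ _ _).symm)))

lemma compFunctor_faithful : ((LL.cone F).compFunctor X).Faithful where
  map_injective {s t} θ η e := by
    ext x
    exact congr((($e).app x.base).app x.pt)

/-- A modification already has a component at every object of `LL F`; naturality at `λ_A(g)` is that
of `φ_A`, and at `λ_u` it is the modification axiom. -/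
lemma compFunctor_full : ((LL.cone F).compFunctor X).Full where
  map_surjective {s t} φ := by
    refine ⟨{ app := fun x => (φ.app x.base).app x.pt, naturality := fun x y f => ?_ }, rfl⟩
    refine LL.naturality_of_ι (fun x => (φ.app x.base).app x.pt) (fun g => (φ.app _).naturality g)
      (fun {a b} u x => ?_) f
    exact (congrArg (· ≫ (φ.app a).app x) (postcomp_tr_app s u x)).symm.trans
      ((φ.comm u x).trans (congrArg ((φ.app b).app _ ≫ ·) (postcomp_tr_app t u x)))

end PseudoCone

/-- Both left exact categories are full subcategories, so full faithfulness is inherited;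
surjectivity on objects also needs the induced functor to be left exact. -/
lemma PseudoConeFl.compFunctor_isIso [TwoFiltered A] (hA : EqualizesTwoCells A)
    [∀ a : A, HasFiniteLimits (F.obj a)]
    [∀ {a b : A} (u : a ⟶ b), PreservesFiniteLimits (F.map u).toFunctor]
    (hl : ∀ a : A, PreservesFiniteLimits ((LL.cone F).leg a))
    (X : Type u₃) [Category.{v₃} X] :
    (PseudoConeFl.compFunctor ⟨LL.cone F, hl⟩ X).IsIso := by
  have := PseudoCone.compFunctor_faithful (F := F) (X := X)
  have := PseudoCone.compFunctor_full (F := F) (X := X)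
  have : (LeftExactFunctor.forget (LL F) X ⋙ (LL.cone F).compFunctor X).Faithful := inferInstance
  have : (LeftExactFunctor.forget (LL F) X ⋙ (LL.cone F).compFunctor X).Full := inferInstance
  refine
    { faithful := ⟨fun {_ _} _ _ e => (LeftExactFunctor.forget (LL F) X ⋙
        (LL.cone F).compFunctor X).map_injective (congrArg (fun k => k.hom) e)⟩
      full := ⟨fun φ => ((LeftExactFunctor.forget (LL F) X ⋙
        (LL.cone F).compFunctor X).map_surjective φ.hom).imp fun _ e =>
          InducedCategory.hom_ext e⟩
      bijective_obj := ⟨fun s t e => ?_, fun h => ?_⟩ }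
  · exact ObjectProperty.FullSubcategory.ext
      (PseudoCone.functor_ext_of_postcomp_eq (congrArg (fun k => k.obj) e))
  · have (a : A) : PreservesFiniteLimits (LL.ι F a ⋙ h.obj.desc) := by
      have e : LL.ι F a ⋙ h.obj.desc = h.obj.leg a := congr(($(h.obj.postcomp_desc)).leg a)
      rw [e]
      exact h.property a
    exact ⟨⟨h.obj.desc, LL.preservesFiniteLimits_of_ι hA _⟩,
      ObjectProperty.FullSubcategory.ext h.obj.postcomp_desc⟩

end LLConstruction

/-- The lemmas keep associators and coherence cells explicit and hold for any pseudofunctor on a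
bicategory; the 2-functor case is a specialization. -/
theorem mainTheorem3 {A : Type u₁} [Bicategory.{w₁, v₁} A] [Bicategory.Strict A]
    [LLConstruction.TwoFiltered A] (hA : LLConstruction.EqualizesTwoCells A)
    (F : StrictPseudofunctor A Cat.{v₂, u₂})
    (hF : ∀ a : A, HasFiniteLimits (F.obj a))
    (hF' : ∀ {a b : A} (u : a ⟶ b), PreservesFiniteLimits (F.map u).toFunctor) :
    HasFiniteLimits (LLConstruction.LL F.toPseudofunctor) ∧
      ∃ hl : ∀ a : A, PreservesFiniteLimits ((LLConstruction.LL.cone F.toPseudofunctor).leg a),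
        ∀ (X : Type u₃) [Category.{v₃} X] [HasFiniteLimits X],
          (LLConstruction.PseudoConeFl.compFunctor
            ⟨LLConstruction.LL.cone F.toPseudofunctor, hl⟩ X).IsEquivalence ∧
          (LLConstruction.PseudoConeFl.compFunctor
            ⟨LLConstruction.LL.cone F.toPseudofunctor, hl⟩ X).IsIso := by
  have hl := LLConstruction.LL.preservesFiniteLimits_ι (F := F.toPseudofunctor) hA
  refine ⟨LLConstruction.LL.hasFiniteLimits hA, hl, fun X _ _ => ?_⟩
  have := LLConstruction.PseudoConeFl.compFunctor_isIso hA hl X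
  exact ⟨inferInstance, this⟩
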